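/- By convention every dimension of the empty set is $-1$. For a metric space $X$ let $\dim_H X$ be its Hausdorff dimension. An embedding $f:X\to Y$ of metric spaces is quasisymmetric if there is a homeomorphism $\eta:[0,\infty)\to[0,\infty)$ such that $d_X(x,a)\le t\,d_X(x,b)$ implies $d_Y(f(x),f(a))\le \eta(t)\,d_Y(f(x),f(b))$ for all $x,a,b\in X$ and all $t>0$. The conformal dimension of $X$ is $$\dim_C X=\inf\{\dim_H f(X): f \text{ is a quasisymmetric embedding of } X \text{ into a metric space}\}.$$ The topological Hausdorff dimension and the topological conformal dimension of a nonempty metric space $X$ are $$\dim_{tH}X=\inf\{c: X\text{ has a basis }\mathcal U\text{ of its topology such that }\dim_H\partial U\le c-1\text{ for all }U\in\mathcal U\},$$ $$\dim_{tC}X=\inf\{c: X\text{ has a basis }\mathcal U\text{ of its topology such that }\dim_C\partial U\le c-1\text{ for all }U\in\mathcal U\}.$$ Let $M\subset\mathbb R^3$ be the Menger sponge with the Euclidean metric, that is, $M=\bigcap_{n\ge0}M_n$, where $M_0=[0,1]^3$ and $M_{n+1}=\bigcup_{d}\tfrac13(M_n+d)$, the union being over the $20$ vectors $d\in\{0,1,2\}^3$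 with at most one coordinate equal to $1$. Then $$\dim_{tH}M=1+\frac{\ln 4}{\ln 3}\qquad\text{and}\qquad \dim_{tC}M=1.$$ -/

import Mathlib

open Set Topology TopologicalSpace
open scoped NNReal ENNReal

noncomputable section

universe u v

/-- A quasisymmetric embedding: a topological embedding `f` admitting a homeomorphism `η` of
`[0, ∞)` such that `d(x, a) ≤ t d(x, b)` implies `d(f x, f a) ≤ η(t) d(f x, f b)`. -/
def IsQuasisymmetric {X : Type u} {Y : Type v} [MetricSpace X] [MetricSpace Y]
    (f : X → Y) : Prop :=
  IsEmbedding f ∧ ∃ η : ℝ≥0 ≃ₜ ℝ≥0, ∀ x a b : X, ∀ t : ℝ≥0, 0 < t →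
    dist x a ≤ t * dist x b → dist (f x) (f a) ≤ η t * dist (f x) (f b)

open Classical in
/-- Hausdorff dimension of a subset of a metric space, with the convention that the empty set has
dimension `-1`. -/
def hausdorffDim {X : Type u} [MetricSpace X] (s : Set X) : EReal :=
  if s = ∅ then -1 else ((dimH s : ℝ≥0∞) : EReal)

/-- Conformal dimension: the infimum of the Hausdorff dimensions of all quasisymmetric images of
`X`. (Replacing `Y` by the image of `f`, which is in bijection with `X`, one sees that target
spaces in the universe of `X` suffice.) -/
def conformalDim (X : Type u) [MetricSpace X] : EReal :=
  sInf {r : EReal | ∃ (Y : Type u) (_ : MetricSpace Y) (f : X → Y),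
    IsQuasisymmetric f ∧ r = hausdorffDim (range f)}

open Classical in
/-- Topological Hausdorff dimension of a metric space (`-1` for the empty space). -/
def topologicalHausdorffDim (X : Type u) [MetricSpace X] : EReal :=
  if IsEmpty X then -1 else
    sInf {c : EReal | ∃ B : Set (Set X), IsTopologicalBasis B ∧
      ∀ U ∈ B, hausdorffDim (frontier U) ≤ c - 1}

open Classical in
/-- Topological conformal dimension of a metric space (`-1` for the empty space). -/
def topologicalConformalDim (X : Type u) [MetricSpace X] : EReal :=
  if IsEmpty X then -1 else
    sInf {c : EReal | ∃ B : Set (Set X), IsTopologicalBasis B ∧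
      ∀ U ∈ B, conformalDim (frontier U) ≤ c - 1}

/-- The positions of the subcubes kept when a cube is divided into 27 congruent subcubes: at most
one of the three coordinates is the middle one. There are 20 of them (the central subcube and the
six subcubes in the centres of the faces are removed). -/
def IsMengerDigit (d : Fin 3 → Fin 3) : Prop :=
  ∀ i j : Fin 3, d i = 1 → d j = 1 → i = j

/-- The similarity of ratio `1/3` that maps the unit cube onto its subcube at position `d`. -/
def mengerMap (d : Fin 3 → Fin 3) (x : EuclideanSpace ℝ (Fin 3)) : EuclideanSpace ℝ (Fin 3) :=
  WithLp.toLp 2 fun i => (x i + ((d i : ℕ) : ℝ)) / 3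

/-- The `n`-th stage of the construction of the Menger sponge: a union of `20 ^ n` closed cubes
of side `3 ^ (-n)`. -/
def preMengerSponge : ℕ → Set (EuclideanSpace ℝ (Fin 3))
  | 0 => {x | ∀ i, x i ∈ Icc (0 : ℝ) 1}
  | n + 1 => ⋃ (d : Fin 3 → Fin 3) (_ : IsMengerDigit d), mengerMap d '' preMengerSponge n

/-- The Menger sponge, a subset of Euclidean 3-space. -/
def mengerSponge : Set (EuclideanSpace ℝ (Fin 3)) := ⋂ n, preMengerSponge n

end

open MeasureTheory Filter Real

universe u v

/-- The similarity dimension `log 4 / log 3` of the Cantor dust. -/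
noncomputable def dustDim : ℝ≥0 := ⟨Real.log 4 / Real.log 3, by positivity⟩

lemma coe_dustDim : (dustDim : ℝ) = Real.log 4 / Real.log 3 := rfl

lemma dustDim_pos : 0 < dustDim := by
  rw [← NNReal.coe_pos, coe_dustDim]; positivity

lemma three_rpow_dustDim : (3 : ℝ) ^ (dustDim : ℝ) = 4 := by
  rw [coe_dustDim, Real.rpow_def_of_pos (by norm_num), mul_div_cancel₀ _ (by positivity),
    Real.exp_log (by norm_num)]

lemma inv_three_pow_rpow_dustDim (n : ℕ) :
    (((3 : ℝ) ^ n)⁻¹) ^ (dustDim : ℝ) = ((4 : ℝ) ^ n)⁻¹ := by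
  rw [Real.inv_rpow (by positivity), ← Real.rpow_natCast, ← Real.rpow_mul (by norm_num), mul_comm,
    Real.rpow_mul (by norm_num), three_rpow_dustDim, Real.rpow_natCast]

/-- The product of two ternary Cantor sets. -/
def cantorDust : Set (Fin 2 → ℝ) := {c | ∀ j, c j ∈ cantorSet}

/-- The point of the Cantor dust with a given sequence of digits. -/
noncomputable def dustPoint (a : ℕ → Fin 2 → Bool) : Fin 2 → ℝ :=
  fun j => ofDigits fun k => cond (a k j) (2 : Fin 3) 0

lemma range_dustPoint : range dustPoint = cantorDust := by
  ext c
  constructor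
  · rintro ⟨a, rfl⟩ j
    exact ofDigits_bool_to_fin_three_mem_cantorSet _
  · intro hc
    refine ⟨fun k j => (cantorToBinary (c j)).get k, funext fun j => ?_⟩
    exact ofDigits_cantorToTernary (hc j)

lemma dist_dustPoint_le {a b : ℕ → Fin 2 → Bool} {n : ℕ} (h : ∀ i < n, a i = b i) :
    dist (dustPoint a) (dustPoint b) ≤ ((3 : ℝ) ^ n)⁻¹ := by
  refine (dist_pi_le_iff (by positivity)).2 fun j => ?_
  rw [Real.dist_eq]
  simpa [dustPoint] using abs_ofDigits_sub_ofDigits_le (b := 3) (n := n)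
    (x := fun k => cond (a k j) (2 : Fin 3) 0) (y := fun k => cond (b k j) (2 : Fin 3) 0)
    fun i hi => by rw [h i hi]

lemma le_abs_ofDigits_sub_ofDigits {a b : ℕ → Bool} {n : ℕ} (h : ∀ i < n, a i = b i)
    (hn : a n ≠ b n) :
    ((3 : ℝ) ^ (n + 1))⁻¹ ≤ |ofDigits (fun k => cond (a k) (2 : Fin 3) 0) -
      ofDigits (fun k => cond (b k) (2 : Fin 3) 0)| := by
  rw [ofDigits_eq_sum_add_ofDigits _ (n + 1),
    ofDigits_eq_sum_add_ofDigits (fun k => cond (b k) (2 : Fin 3) 0) (n + 1),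
    Finset.sum_range_succ, Finset.sum_range_succ]
  have hs : ∑ x ∈ Finset.range n, ofDigitsTerm (fun k => cond (a k) (2 : Fin 3) 0) x =
      ∑ x ∈ Finset.range n, ofDigitsTerm (fun k => cond (b k) (2 : Fin 3) 0) x :=
    Finset.sum_congr rfl fun i hi => by simp [ofDigitsTerm, h i (Finset.mem_range.1 hi)]
  rw [hs]
  set r := ofDigits (fun i => cond (a (i + (n + 1))) (2 : Fin 3) 0)
  set r' := ofDigits (fun i => cond (b (i + (n + 1))) (2 : Fin 3) 0)
  have h1 : 0 ≤ r := ofDigits_nonneg _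
  have h2 : r ≤ 1 := ofDigits_le_one _
  have h3 : 0 ≤ r' := ofDigits_nonneg _
  have h4 : r' ≤ 1 := ofDigits_le_one _
  have hp : (0 : ℝ) < ((3 : ℝ) ^ (n + 1))⁻¹ := by positivity
  simp only [ofDigitsTerm, Nat.cast_ofNat]
  set q := ((3 : ℝ) ^ (n + 1))⁻¹
  rw [le_abs]
  cases ha : a n <;> cases hb : b n
  · simp_all
  · right
    simp
    nlinarith
  · left
    simp
    nlinarith
  · simp_all

lemma le_dist_dustPoint {a b : ℕ → Fin 2 → Bool} {n : ℕ} (h : ∀ i < n, a i = b i)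
    (hn : a n ≠ b n) : ((3 : ℝ) ^ (n + 1))⁻¹ ≤ dist (dustPoint a) (dustPoint b) := by
  obtain ⟨j, hj⟩ := Function.ne_iff.1 hn
  refine le_trans ?_ (dist_le_pi_dist _ _ j)
  exact le_abs_ofDigits_sub_ofDigits (a := fun k => a k j) (b := fun k => b k j)
    (fun i hi => by simp [h i hi]) hj

lemma dimH_cantorDust_le : dimH cantorDust ≤ dustDim := by
  refine dimH_le_of_hausdorffMeasure_ne_top (ne_top_of_le_ne_top ENNReal.one_ne_top ?_)
  have hr : Tendsto (fun n : ℕ => ENNReal.ofReal ((3 : ℝ) ^ n)⁻¹) atTop (𝓝 0) := by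
    rw [← ENNReal.ofReal_zero]
    refine ENNReal.tendsto_ofReal ?_
    simpa using tendsto_pow_atTop_nhds_zero_of_lt_one (r := (3 : ℝ)⁻¹) (by norm_num) (by norm_num)
  let t : ∀ n : ℕ, (Fin n → Fin 2 → Bool) → Set (Fin 2 → ℝ) := fun n w =>
    dustPoint '' {a | ∀ i : Fin n, a i = w i}
  have ht : ∀ n w, Metric.ediam (t n w) ≤ ENNReal.ofReal ((3 : ℝ) ^ n)⁻¹ := by
    refine fun n w => Metric.ediam_le ?_
    rintro _ ⟨a, ha, rfl⟩ _ ⟨b, hb, rfl⟩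
    rw [edist_dist]
    exact ENNReal.ofReal_le_ofReal (dist_dustPoint_le fun i hi =>
      (ha ⟨i, hi⟩).trans (hb ⟨i, hi⟩).symm)
  refine (Measure.hausdorffMeasure_le_liminf_sum (dustDim : ℝ) cantorDust _ hr t
    (Eventually.of_forall ht) (Eventually.of_forall fun n => ?_)).trans ?_
  · rw [← range_dustPoint]
    rintro _ ⟨a, rfl⟩
    exact mem_iUnion.2 ⟨fun i => a i, a, fun i => rfl, rfl⟩
  · refine (liminf_le_liminf (v := fun _ : ℕ => (1 : ℝ≥0∞)) (Eventually.of_forall fun n => ?_)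
      ).trans (by simp)
    calc ∑ w, Metric.ediam (t n w) ^ (dustDim : ℝ)
        ≤ ∑ _w : Fin n → Fin 2 → Bool, ENNReal.ofReal ((4 : ℝ) ^ n)⁻¹ := by
          refine Finset.sum_le_sum fun w _ => ?_
          refine (ENNReal.rpow_le_rpow (ht n w) dustDim.coe_nonneg).trans ?_
          rw [ENNReal.ofReal_rpow_of_nonneg (by positivity) dustDim.coe_nonneg, inv_three_pow_rpow_dustDim]
      _ = 1 := by
          rw [Finset.sum_const, nsmul_eq_mul, Finset.card_univ, ENNReal.ofReal_inv_of_pos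
            (by positivity), ENNReal.ofReal_pow (by norm_num)]
          simp only [Fintype.card_fun, Fintype.card_fin, Fintype.card_bool]
          norm_num
          exact ENNReal.mul_inv_cancel (by simp) (by simp)

lemma le_dimH_cantorDust : (dustDim : ℝ≥0∞) ≤ dimH cantorDust := by
  have e : (Fin 2 → Bool) ≃ Fin 4 := Fintype.equivFinOfCardEq (by simp)
  let h : (ℕ → Fin 2 → Bool) → ℝ := fun a => ofDigits fun k => e (a k)
  have hH : ∀ a b, dist (h a) (h b) ≤ 4 * dist (dustPoint a) (dustPoint b) ^ (dustDim : ℝ) := by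
    intro a b
    rcases eq_or_ne a b with rfl | hab
    · simp only [dist_self]; positivity
    have h1 : ∀ i < PiNat.firstDiff a b, a i = b i := fun i hi =>
      PiNat.apply_eq_of_lt_firstDiff hi
    have h2 := PiNat.apply_firstDiff_ne hab
    set n := PiNat.firstDiff a b
    have h3 : dist (h a) (h b) ≤ ((4 : ℝ) ^ n)⁻¹ := by
      rw [Real.dist_eq]
      simpa using abs_ofDigits_sub_ofDigits_le (b := 4) (n := n) (x := fun k => e (a k))
        (y := fun k => e (b k)) fun i hi => by rw [h1 i hi]
    have h4 := Real.rpow_le_rpow (by positivity) (le_dist_dustPoint h1 h2) dustDim.coe_nonneg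
    rw [inv_three_pow_rpow_dustDim] at h4
    calc _ ≤ _ := h3
      _ = 4 * ((4 : ℝ) ^ (n + 1))⁻¹ := by rw [pow_succ]; field_simp
      _ ≤ _ := by gcongr
  let f : (Fin 2 → ℝ) → ℝ := h ∘ Function.invFun dustPoint
  have hinv : ∀ x ∈ cantorDust, dustPoint (Function.invFun dustPoint x) = x := by
    intro x hx
    rw [← range_dustPoint] at hx
    exact Function.invFun_eq hx
  have hf : HolderOnWith 4 dustDim f cantorDust := by
    intro x hx y hy
    have := hH (Function.invFun dustPoint x) (Function.invFun dustPoint y)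
    rw [hinv x hx, hinv y hy] at this
    rw [edist_dist, edist_dist, ENNReal.ofReal_rpow_of_nonneg dist_nonneg dustDim.coe_nonneg]
    refine (ENNReal.ofReal_le_ofReal this).trans ?_
    rw [ENNReal.ofReal_mul (by norm_num)]
    simp
  have himg : Icc (0 : ℝ) 1 ⊆ f '' cantorDust := by
    intro y hy
    obtain ⟨d, -, rfl⟩ := ofDigits_SurjOn (b := 4) (by norm_num) hy
    refine ⟨dustPoint fun k => e.symm (d k), range_dustPoint ▸ mem_range_self _, ?_⟩
    have h0 := hH (Function.invFun dustPoint (dustPoint fun k => e.symm (d k)))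
      (fun k => e.symm (d k))
    rw [hinv _ (range_dustPoint ▸ mem_range_self _), dist_self,
      Real.zero_rpow (NNReal.coe_pos.2 dustDim_pos).ne', mul_zero] at h0
    have h1 := dist_le_zero.1 h0
    simpa [f, h] using h1
  have h1 : dimH (Icc (0 : ℝ) 1) = 1 := by
    simpa using Real.dimH_of_mem_nhds (Icc_mem_nhds (by norm_num : (0 : ℝ) < 1 / 2) (by norm_num))
  have h2 := (dimH_mono himg).trans (hf.dimH_image_le dustDim_pos)
  rw [h1, ENNReal.le_div_iff_mul_le (Or.inl (by simpa using dustDim_pos.ne')) (Or.inl (by simp)),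
    one_mul] at h2
  exact h2

lemma hausdorffDim_le {X : Type u} [MetricSpace X] (s : Set X) :
    hausdorffDim s ≤ ((dimH s : ℝ≥0∞) : EReal) := by
  unfold hausdorffDim
  split_ifs with h
  · exact le_trans (by norm_num) (EReal.coe_ennreal_nonneg _)
  · exact le_rfl

lemma hausdorffDim_of_nonempty {X : Type u} [MetricSpace X] {s : Set X} (h : s.Nonempty) :
    hausdorffDim s = ((dimH s : ℝ≥0∞) : EReal) :=
  if_neg h.ne_empty

lemma conformalDim_nonneg (X : Type u) [MetricSpace X] [Nonempty X] : 0 ≤ conformalDim X := by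
  refine le_sInf ?_
  rintro _ ⟨Y, _, f, -, rfl⟩
  rw [hausdorffDim_of_nonempty (range_nonempty f)]
  exact EReal.coe_ennreal_nonneg _

/-- The `p`-th power of an ultrametric-type distance function, as a metric space structure. -/
abbrev ultrametricPow {X : Type u} (ρ : X → X → ℝ) (p : ℕ) (hp : p ≠ 0)
    (hself : ∀ x, ρ x x = 0) (hcomm : ∀ x y, ρ x y = ρ y x) (hnonneg : ∀ x y, 0 ≤ ρ x y)
    (hultra : ∀ x y z, ρ x z ≤ max (ρ x y) (ρ y z)) (heq : ∀ x y, ρ x y = 0 → x = y) :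
    MetricSpace X where
  dist x y := ρ x y ^ p
  dist_self x := by simp [hself, hp]
  dist_comm x y := by simp [hcomm x y]
  dist_triangle x y z := by
    rcases le_max_iff.1 (hultra x y z) with h | h
    · exact (pow_le_pow_left₀ (hnonneg _ _) h p).trans
        (le_add_of_nonneg_right (pow_nonneg (hnonneg _ _) _))
    · exact (pow_le_pow_left₀ (hnonneg _ _) h p).trans
        (le_add_of_nonneg_left (pow_nonneg (hnonneg _ _) _))
  eq_of_dist_eq_zero {x y} h := heq x y (by simpa [hp] using h)

/-- A map which distorts distances like a power is quasisymmetric. -/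
lemma isQuasisymmetric_of_pow {X : Type u} {Y : Type v} [MetricSpace X] [MetricSpace Y]
    (f : X → Y) {p : ℕ} (hp : p ≠ 0) {L : ℝ≥0} (hL : L ≠ 0)
    (h1 : ∀ x y, dist (f x) (f y) ≤ L * dist x y ^ p)
    (h2 : ∀ x y, dist x y ^ p ≤ L * dist (f x) (f y)) : IsQuasisymmetric f := by
  have hL' : (0 : ℝ) < L := by positivity
  have hinj : Function.Injective f := by
    intro x y hxy
    have := h2 x y
    rw [hxy, dist_self, mul_zero] at this
    exact dist_le_zero.1 (le_of_eq (pow_eq_zero_iff hp |>.1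
      (le_antisymm this (pow_nonneg dist_nonneg p))))
  refine ⟨⟨IsUniformInducing.isInducing (f := f) ?_, hinj⟩, ?_⟩
  · refine Metric.isUniformInducing_iff.2 ⟨?_, fun δ hδ => ⟨δ ^ p / L, by positivity, ?_⟩⟩
    · refine Metric.uniformContinuous_iff.2 fun ε hε => ?_
      have ht : Tendsto (fun r : ℝ => (L : ℝ) * r ^ p) (𝓝 0) (𝓝 0) := by
        have : Continuous (fun r : ℝ => (L : ℝ) * r ^ p) := by fun_prop
        simpa [hp] using this.tendsto 0
      obtain ⟨δ, hδ, h⟩ := Metric.eventually_nhds_iff.1 (ht.eventually (gt_mem_nhds hε))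
      refine ⟨δ, hδ, fun {a b} hab => (h1 a b).trans_lt (h ?_)⟩
      simpa [abs_of_nonneg] using hab
    · intro a b hab
      rw [lt_div_iff₀ hL', mul_comm] at hab
      exact lt_of_pow_lt_pow_left₀ p hδ.le ((h2 a b).trans_lt hab)
  · have hp' : (0 : ℝ) < p := by positivity
    refine ⟨(NNReal.orderIsoRpow (p : ℝ) hp').toHomeomorph.trans
      (Homeomorph.mulLeft₀ (L * L) (mul_ne_zero hL hL)), fun x a b t ht h => ?_⟩
    have hη : (((NNReal.orderIsoRpow (p : ℝ) hp').toHomeomorph.trans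
      (Homeomorph.mulLeft₀ (L * L) (mul_ne_zero hL hL))) t : ℝ≥0) = L * L * t ^ p := by
      simp
    rw [hη]
    push_cast
    calc dist (f x) (f a) ≤ L * dist x a ^ p := h1 x a
      _ ≤ L * (t * dist x b) ^ p := by gcongr
      _ = L * (t : ℝ) ^ p * dist x b ^ p := by ring
      _ ≤ L * (t : ℝ) ^ p * (L * dist (f x) (f b)) := by gcongr; exact h2 x b
      _ = _ := by ring

/-- A finite-dimensional space which is bi-Lipschitz to an ultrametric space has conformal
dimension at most `0`. -/
lemma conformalDim_nonpos_of_ultrametric {X : Type u} [MetricSpace X] (ρ : X → X → ℝ)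
    (hcomm : ∀ x y, ρ x y = ρ y x) (hultra : ∀ x y z, ρ x z ≤ max (ρ x y) (ρ y z))
    {L : ℝ≥0} (hL : L ≠ 0) (h1 : ∀ x y, ρ x y ≤ L * dist x y)
    (h2 : ∀ x y, dist x y ≤ L * ρ x y) (hdim : dimH (univ : Set X) ≠ ∞) :
    conformalDim X ≤ 0 := by
  have hL' : (0 : ℝ) < L := by positivity
  have hnonneg : ∀ x y, 0 ≤ ρ x y := fun x y =>
    nonneg_of_mul_nonneg_right (dist_nonneg.trans (h2 x y)) hL'
  have hself : ∀ x, ρ x x = 0 := fun x => le_antisymm (by simpa using h1 x x) (hnonneg x x)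
  have heq : ∀ x y, ρ x y = 0 → x = y := fun x y h =>
    dist_le_zero.1 (by simpa [h] using h2 x y)
  have key : ∀ p : ℕ, p ≠ 0 →
      conformalDim X ≤ ((dimH (univ : Set X) / p : ℝ≥0∞) : EReal) := by
    intro p hp
    obtain ⟨Y, _, f, hf⟩ : ∃ (Y : Type u) (_ : MetricSpace Y) (f : X → Y),
        ∀ x y, dist (f x) (f y) = ρ x y ^ p :=
      ⟨X, ultrametricPow ρ p hp hself hcomm hnonneg hultra heq, id, fun _ _ => rfl⟩
    have h1' : ∀ x y, dist (f x) (f y) ≤ (L ^ p : ℝ≥0) * dist x y ^ p := fun x y => by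
      rw [hf, NNReal.coe_pow, ← mul_pow]
      exact pow_le_pow_left₀ (hnonneg x y) (h1 x y) p
    have h2' : ∀ x y, dist x y ^ p ≤ (L ^ p : ℝ≥0) * dist (f x) (f y) := fun x y => by
      rw [hf, NNReal.coe_pow, ← mul_pow]
      exact pow_le_pow_left₀ dist_nonneg (h2 x y) p
    have hq := isQuasisymmetric_of_pow f hp (pow_ne_zero p hL) h1' h2'
    have hH : HolderWith (L ^ p) (p : ℝ≥0) f := by
      intro x y
      rw [edist_dist, edist_dist, NNReal.coe_natCast, ENNReal.rpow_natCast,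
        ← ENNReal.ofReal_pow dist_nonneg]
      refine (ENNReal.ofReal_le_ofReal (h1' x y)).trans ?_
      rw [ENNReal.ofReal_mul (NNReal.coe_nonneg _), ENNReal.ofReal_coe_nnreal]
    have hle : conformalDim X ≤ hausdorffDim (range f) := sInf_le ⟨Y, _, f, hq, rfl⟩
    refine hle.trans ((hausdorffDim_le _).trans ?_)
    exact EReal.coe_ennreal_le_coe_ennreal_iff.2
      (by simpa using hH.dimH_range_le (by positivity))
  have hlim : Tendsto (fun p : ℕ => ((dimH (univ : Set X) / p : ℝ≥0∞) : EReal)) atTop (𝓝 0) := by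
    have h : Tendsto (fun p : ℕ => dimH (univ : Set X) / p) atTop (𝓝 0) := by
      simpa using ENNReal.Tendsto.const_div (ENNReal.tendsto_nat_nhds_top) (Or.inr hdim)
    exact (continuous_coe_ennreal_ereal.tendsto 0).comp h
  exact ge_of_tendsto hlim ((eventually_ne_atTop 0).mono key)

/-- The ultrametric distance on a space defined by a sequence of codes. -/
noncomputable def codeDist {X : Type u} {E : Type v} (c : X → ℕ → E) (x y : X) : ℝ :=
  open Classical in if c x = c y then 0 else ((3 : ℝ) ^ PiNat.firstDiff (c x) (c y))⁻¹

lemma codeDist_comm {X : Type u} {E : Type v} (c : X → ℕ → E) (x y : X) :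
    codeDist c x y = codeDist c y x := by
  unfold codeDist
  rw [PiNat.firstDiff_comm, propext (eq_comm (a := c x) (b := c y))]

lemma codeDist_nonneg {X : Type u} {E : Type v} (c : X → ℕ → E) (x y : X) :
    0 ≤ codeDist c x y := by
  unfold codeDist
  split_ifs <;> positivity

lemma codeDist_le_max {X : Type u} {E : Type v} (c : X → ℕ → E) (x y z : X) :
    codeDist c x z ≤ max (codeDist c x y) (codeDist c y z) := by
  by_cases hxz : c x = c z
  · rw [codeDist, if_pos hxz]
    exact le_max_of_le_left (codeDist_nonneg c x y)
  by_cases hxy : c x = c y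
  · refine le_max_of_le_right (le_of_eq ?_)
    unfold codeDist
    rw [hxy]
  by_cases hyz : c y = c z
  · refine le_max_of_le_left (le_of_eq ?_)
    unfold codeDist
    rw [hyz]
  have h := PiNat.min_firstDiff_le (c x) (c y) (c z) hxz
  simp only [codeDist, hxz, hxy, hyz, if_false]
  rcases min_le_iff.1 h with h | h
  · refine le_max_of_le_left ?_
    gcongr
    norm_num
  · refine le_max_of_le_right ?_
    gcongr
    norm_num

/-- A finite-dimensional space with codes that determine the distances up to a bounded factor has
conformal dimension at most `0`. -/
lemma conformalDim_nonpos_of_code {X : Type u} {E : Type v} [MetricSpace X] (c : X → ℕ → E)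
    {L : ℝ} (hL : 0 < L)
    (h1 : ∀ x y n, c x n ≠ c y n → ((3 : ℝ) ^ n)⁻¹ ≤ L * dist x y)
    (h2 : ∀ x y n, (∀ i < n, c x i = c y i) → dist x y ≤ L * ((3 : ℝ) ^ n)⁻¹)
    (hdim : dimH (univ : Set X) ≠ ∞) : conformalDim X ≤ 0 := by
  lift L to ℝ≥0 using hL.le
  refine conformalDim_nonpos_of_ultrametric (codeDist c) (codeDist_comm c) (codeDist_le_max c)
    (L := L) (by rintro rfl; simp at hL) (fun x y => ?_) (fun x y => ?_) hdim
  · unfold codeDist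
    split_ifs with h
    · positivity
    · exact h1 x y _ (PiNat.apply_firstDiff_ne h)
  · unfold codeDist
    split_ifs with h
    · have hlim : Tendsto (fun n : ℕ => (L : ℝ) * ((3 : ℝ) ^ n)⁻¹) atTop (𝓝 (L * 0)) := by
        refine Tendsto.const_mul _ ?_
        simpa using tendsto_pow_atTop_nhds_zero_of_lt_one (r := (3 : ℝ)⁻¹) (by norm_num)
          (by norm_num)
      exact ge_of_tendsto hlim (Eventually.of_forall fun n => h2 x y n fun i _ => by rw [h])
    · exact h2 x y _ fun i hi => PiNat.apply_eq_of_lt_firstDiff hi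

lemma preMengerSponge_subset_cube (n : ℕ) {x : EuclideanSpace ℝ (Fin 3)}
    (hx : x ∈ preMengerSponge n) (i : Fin 3) : x i ∈ Icc (0 : ℝ) 1 := by
  induction n generalizing x i with
  | zero => exact hx i
  | succ n ih =>
    obtain ⟨d, -, y, hy, rfl⟩ := by simpa [preMengerSponge] using hx
    have h := ih hy i
    have h2 : ((d i : ℕ) : ℝ) ≤ 2 := by exact_mod_cast Nat.lt_succ_iff.1 (d i).2
    have h0 : (0 : ℝ) ≤ ((d i : ℕ) : ℝ) := by positivity
    simp only [mengerMap, mem_Icc] at h ⊢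
    constructor <;> linarith

lemma mem_preMengerSponge_succ {n : ℕ} {x : EuclideanSpace ℝ (Fin 3)} :
    x ∈ preMengerSponge (n + 1) ↔
      ∃ d, IsMengerDigit d ∧ ∃ y ∈ preMengerSponge n, ∀ j, x j = (y j + ((d j : ℕ) : ℝ)) / 3 := by
  simp only [preMengerSponge, mem_iUnion, mem_image, exists_prop]
  refine exists_congr fun d => and_congr_right fun _ => exists_congr fun y =>
    and_congr_right fun _ => ?_
  constructor
  · rintro rfl j; rfl
  · intro h
    ext j
    exact (h j).symm

lemma mem_preCantorSet_of_slice (m : ℕ) {x : EuclideanSpace ℝ (Fin 3)}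
    (hx : x ∈ preMengerSponge m) {i : Fin 3} (hi : x i = 1 / 2) {j : Fin 3} (hj : j ≠ i) :
    x j ∈ preCantorSet m := by
  induction m generalizing x with
  | zero => exact hx j
  | succ m ih =>
    obtain ⟨d, hd, y, hy, hxy⟩ := mem_preMengerSponge_succ.1 hx
    have hyi := preMengerSponge_subset_cube m hy i
    have h1 := hxy i
    rw [hi] at h1
    have hdi : d i = 1 := by
      generalize d i = e at h1
      obtain ⟨h2, h3⟩ := hyi
      fin_cases e
      · norm_num at h1; linarith
      · rfl
      · norm_num at h1; linarith
    have hyi2 : y i = 1 / 2 := by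
      rw [hdi] at h1
      norm_num at h1
      linarith
    have hdj : d j ≠ 1 := fun h => hj (hd j i h hdi)
    have hyj := ih hy hyi2
    rw [hxy j, preCantorSet_succ]
    generalize d j = e at hdj
    fin_cases e
    · exact Or.inl ⟨y j, hyj, by simp⟩
    · exact absurd rfl hdj
    · exact Or.inr ⟨y j, hyj, by simp [add_comm]⟩

lemma exists_int_add_mem_preMengerSponge (n m : ℕ) {x : EuclideanSpace ℝ (Fin 3)}
    (hx : x ∈ preMengerSponge (n + m)) :
    ∃ v : Fin 3 → ℤ, ∃ y ∈ preMengerSponge m, ∀ j, 3 ^ n * x j = v j + y j := by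
  induction n generalizing x with
  | zero => exact ⟨0, x, by simpa using hx, by simp⟩
  | succ n ih =>
    rw [Nat.add_right_comm] at hx
    obtain ⟨d, -, z, hz, hxz⟩ := mem_preMengerSponge_succ.1 hx
    obtain ⟨v, y, hy, h⟩ := ih hz
    refine ⟨fun j => v j + 3 ^ n * (d j : ℕ), y, hy, fun j => ?_⟩
    rw [hxz j]
    push_cast
    linear_combination h j

/-- The points which, after magnification by `3 ^ n`, lie in an integer translate of a Cantor dust
in the middle slice of the unit cube orthogonal to a coordinate direction. -/
def dustSlices (n : ℕ) : Set (EuclideanSpace ℝ (Fin 3)) :=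
  {x | ∃ i, Int.fract (3 ^ n * x i) = 1 / 2 ∧ ∀ j ≠ i, Int.fract (3 ^ n * x j) ∈ cantorSet}

lemma mem_dustSlices_of_mem_mengerSponge {n : ℕ} {x : EuclideanSpace ℝ (Fin 3)}
    (hx : x ∈ mengerSponge) {i : Fin 3} {q : ℤ} (hi : 3 ^ n * x i = q + 1 / 2) :
    x ∈ dustSlices n := by
  refine ⟨i, ?_, fun j hj => mem_iInter.2 fun m => ?_⟩
  · rw [hi, Int.fract_intCast_add, Int.fract_eq_self]
    norm_num
  obtain ⟨v, y, hy, h⟩ := exists_int_add_mem_preMengerSponge n m (mem_iInter.1 hx (n + m))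
  have hyi := preMengerSponge_subset_cube m hy i
  have h2 : y i = 1 / 2 := by
    have h3 : y i = ((q - v i : ℤ) : ℝ) + 1 / 2 := by
      push_cast
      linarith [h i]
    rw [h3] at hyi ⊢
    have h4 : ((-1 : ℤ) : ℝ) < ((q - v i : ℤ) : ℝ) := by
      push_cast
      push_cast at hyi
      linarith [hyi.1]
    have h5 : ((q - v i : ℤ) : ℝ) < ((1 : ℤ) : ℝ) := by
      push_cast
      push_cast at hyi
      linarith [hyi.2]
    have h6 : q - v i = 0 := by
      have := Int.cast_lt.1 h4
      have := Int.cast_lt.1 h5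
      omega
    rw [h6]
    simp
  have hyj := mem_preCantorSet_of_slice m hy h2 hj
  have hyj' := preCantorSet_subset_unitInterval hyj
  rw [h j, Int.fract_intCast_add]
  rcases eq_or_lt_of_le hyj'.2 with h1 | h1
  · rw [h1, Int.fract_one]
    exact zero_mem_preCantorSet m
  · rwa [Int.fract_eq_self.2 ⟨hyj'.1, h1⟩]

lemma mem_cantorSet_imp {x : ℝ} (hx : x ∈ cantorSet) :
    ∃ y ∈ cantorSet, x = y / 3 ∨ x = (2 + y) / 3 := by
  rw [cantorSet_eq_union_halves] at hx
  rcases hx with ⟨y, hy, rfl⟩ | ⟨y, hy, rfl⟩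
  · exact ⟨y, hy, Or.inl rfl⟩
  · exact ⟨y, hy, Or.inr rfl⟩

lemma fract_three_mul_mem_cantorSet {u : ℝ} (hu : Int.fract u ∈ cantorSet) :
    Int.fract (3 * u) ∈ cantorSet := by
  obtain ⟨y, hy, h⟩ := mem_cantorSet_imp hu
  obtain ⟨z, hz⟩ : ∃ z : ℤ, 3 * u = z + y := by
    have := Int.floor_add_fract u
    rcases h with h | h
    · exact ⟨3 * ⌊u⌋, by push_cast; linarith⟩
    · exact ⟨3 * ⌊u⌋ + 2, by push_cast; linarith⟩
  rw [hz, Int.fract_intCast_add]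
  have hy' := cantorSet_subset_unitInterval hy
  rcases eq_or_lt_of_le hy'.2 with h1 | h1
  · rw [h1, Int.fract_one]
    exact zero_mem_cantorSet
  · rwa [Int.fract_eq_self.2 ⟨hy'.1, h1⟩]

lemma fract_three_mul_eq_half {u : ℝ} (hu : Int.fract u = 1 / 2) :
    Int.fract (3 * u) = 1 / 2 := by
  have h := Int.floor_add_fract u
  have h2 : 3 * u = ((3 * ⌊u⌋ + 1 : ℤ) : ℝ) + 1 / 2 := by push_cast; linarith
  rw [h2, Int.fract_intCast_add, Int.fract_eq_self]
  norm_num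

lemma dustSlices_subset_add (n k : ℕ) : dustSlices n ⊆ dustSlices (n + k) := by
  induction k with
  | zero => exact subset_rfl
  | succ k ih =>
    intro x hx
    obtain ⟨i, hi, h⟩ := ih hx
    refine ⟨i, ?_, fun j hj => ?_⟩
    · rw [← add_assoc, pow_succ', mul_assoc]
      exact fract_three_mul_eq_half hi
    · rw [← add_assoc, pow_succ', mul_assoc]
      exact fract_three_mul_mem_cantorSet (h j hj)

lemma fract_add_mem_Icc_of_mem_dustSlices {n : ℕ} {x : EuclideanSpace ℝ (Fin 3)}
    (hx : x ∈ dustSlices n) (j : Fin 3) :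
    Int.fract (3 ^ n * x j + 7 / 12) ∈ Icc (1 / 12 : ℝ) (11 / 12) := by
  obtain ⟨i, hi, h⟩ := hx
  have hfr := Int.floor_add_fract (3 ^ n * x j)
  have hlt := Int.fract_lt_one (3 ^ n * x j)
  have hnn := Int.fract_nonneg (3 ^ n * x j)
  set r := Int.fract (3 ^ n * x j) with hr
  have hcase : r ≤ 1 / 3 ∨ (1 / 2 ≤ r ∧ r < 1) := by
    by_cases hj : j = i
    · subst hj
      exact Or.inr ⟨hi.ge, hlt⟩
    · obtain ⟨y, hy, hy'⟩ := mem_cantorSet_imp (h j hj)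
      have := cantorSet_subset_unitInterval hy
      rw [← hr] at hy'
      rcases hy' with hy' | hy'
      · left; linarith [this.2]
      · right; exact ⟨by linarith [this.1], hlt⟩
  rcases hcase with hc | ⟨hc, hc'⟩
  · have : 3 ^ n * x j + 7 / 12 = ((⌊3 ^ n * x j⌋ : ℤ) : ℝ) + (r + 7 / 12) := by linarith
    rw [this, Int.fract_intCast_add, Int.fract_eq_self.2 ⟨by linarith, by linarith⟩]
    constructor <;> linarith
  · have : 3 ^ n * x j + 7 / 12 = ((⌊3 ^ n * x j⌋ + 1 : ℤ) : ℝ) + (r - 5 / 12) := by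
      push_cast; linarith
    rw [this, Int.fract_intCast_add, Int.fract_eq_self.2 ⟨by linarith, by linarith⟩]
    constructor <;> linarith

lemma le_abs_sub_of_floor_ne {z w : ℝ} (hz : Int.fract z ∈ Icc (1 / 12 : ℝ) (11 / 12))
    (hw : Int.fract w ∈ Icc (1 / 12 : ℝ) (11 / 12)) (h : ⌊z⌋ ≠ ⌊w⌋) : 1 / 6 ≤ |z - w| := by
  have h1 := Int.floor_add_fract z
  have h2 := Int.floor_add_fract w
  rw [le_abs]
  rcases lt_or_gt_of_ne h with h | h
  · right
    have : ((⌊z⌋ + 1 : ℤ) : ℝ) ≤ ⌊w⌋ := Int.cast_le.2 h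
    push_cast at this
    linarith [hz.2, hw.1]
  · left
    have : ((⌊w⌋ + 1 : ℤ) : ℝ) ≤ ⌊z⌋ := Int.cast_le.2 h
    push_cast at this
    linarith [hz.1, hw.2]

lemma EuclideanSpace.dist_le_three_mul {x y : EuclideanSpace ℝ (Fin 3)} {r : ℝ}
    (h : ∀ j, |x j - y j| ≤ r) : dist x y ≤ 3 * r := by
  have hr : 0 ≤ r := (abs_nonneg _).trans (h 0)
  rw [EuclideanSpace.dist_eq]
  refine Real.sqrt_le_iff.2 ⟨by positivity, ?_⟩
  have h' : ∀ j, dist (x j) (y j) ^ 2 ≤ r ^ 2 := fun j =>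
    pow_le_pow_left₀ dist_nonneg (by simpa [Real.dist_eq] using h j) 2
  rw [Fin.sum_univ_three]
  nlinarith [h' 0, h' 1, h' 2]

lemma EuclideanSpace.abs_sub_apply_le_dist (x y : EuclideanSpace ℝ (Fin 3)) (j : Fin 3) :
    |x j - y j| ≤ dist x y := by
  rw [dist_eq_norm]
  simpa using PiLp.norm_apply_le (x - y) j

/-- The parametrization of a piece of `dustSlices n` by the Cantor dust. -/
noncomputable def sliceMap (n : ℕ) (i : Fin 3) (v : Fin 3 → ℤ) (c : Fin 2 → ℝ) :
    EuclideanSpace ℝ (Fin 3) :=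
  WithLp.toLp 2 fun k => (v k + (i.insertNth (α := fun _ => ℝ) (1 / 2) c) k) / 3 ^ n

lemma lipschitzWith_sliceMap (n : ℕ) (i : Fin 3) (v : Fin 3 → ℤ) :
    LipschitzWith 3 (sliceMap n i v) := by
  refine LipschitzWith.of_dist_le_mul fun c c' => EuclideanSpace.dist_le_three_mul fun j => ?_
  simp only [sliceMap]
  refine Fin.succAboveCases i ?_ (fun k => ?_) j
  · simp
  · simp only [Fin.insertNth_apply_succAbove]
    rw [← sub_div, add_sub_add_left_eq_sub, abs_div]
    have h3 : (1 : ℝ) ≤ |3 ^ n| := by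
      rw [abs_of_pos (by positivity)]
      exact one_le_pow₀ (by norm_num)
    exact (div_le_self (abs_nonneg _) h3).trans (dist_le_pi_dist c c' k)

lemma dimH_dustSlices_le (n : ℕ) : dimH (dustSlices n) ≤ dustDim := by
  have h : dustSlices n ⊆ ⋃ p : Fin 3 × (Fin 3 → ℤ), sliceMap n p.1 p.2 '' cantorDust := by
    rintro x ⟨i, hi, h⟩
    refine mem_iUnion.2 ⟨(i, fun k => ⌊3 ^ n * x k⌋),
      fun k => Int.fract (3 ^ n * x (i.succAbove k)), fun k => h _ (Fin.succAbove_ne i k), ?_⟩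
    ext j
    simp only [sliceMap]
    refine Fin.succAboveCases i ?_ (fun k => ?_) j
    · rw [Fin.insertNth_apply_same, ← hi, Int.floor_add_fract]
      field_simp
    · rw [Fin.insertNth_apply_succAbove, Int.floor_add_fract]
      field_simp
  refine (dimH_mono h).trans ?_
  rw [dimH_iUnion]
  exact iSup_le fun p => ((lipschitzWith_sliceMap n p.1 p.2).dimH_image_le _).trans
    dimH_cantorDust_le

lemma conformalDim_nonpos_of_dustSlices {X : Type u} [MetricSpace X]
    {f : X → EuclideanSpace ℝ (Fin 3)} (hf : Isometry f) {n : ℕ} (hS : ∀ x, f x ∈ dustSlices n)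
    (hcube : ∀ x j, f x j ∈ Icc (0 : ℝ) 1) : conformalDim X ≤ 0 := by
  have h3n : (1 : ℝ) ≤ 3 ^ n := one_le_pow₀ (by norm_num)
  refine conformalDim_nonpos_of_code (fun x k j => ⌊3 ^ (n + k) * f x j + 7 / 12⌋)
    (L := 9 * 3 ^ n) (by positivity) ?_ ?_ ?_
  · intro x y k hne
    obtain ⟨j, hj⟩ := Function.ne_iff.1 hne
    have h1 := le_abs_sub_of_floor_ne
      (fract_add_mem_Icc_of_mem_dustSlices (dustSlices_subset_add n k (hS x)) j)
      (fract_add_mem_Icc_of_mem_dustSlices (dustSlices_subset_add n k (hS y)) j) hj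
    rw [add_sub_add_right_eq_sub, ← mul_sub, abs_mul, abs_of_pos (by positivity)] at h1
    have h2 := EuclideanSpace.abs_sub_apply_le_dist (f x) (f y) j
    rw [hf.dist_eq] at h2
    rw [inv_le_iff_one_le_mul₀ (by positivity)]
    calc (1 : ℝ) ≤ 9 * (3 ^ (n + k) * |f x j - f y j|) := by linarith
      _ ≤ 9 * (3 ^ (n + k) * dist x y) := by gcongr
      _ = _ := by ring
  · intro x y k h
    rw [← hf.dist_eq]
    rcases k with _ | k
    · refine (EuclideanSpace.dist_le_three_mul (r := 1) fun j => ?_).trans ?_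
      · have h1 := hcube x j
        have h2 := hcube y j
        exact abs_sub_le_iff.2 ⟨by linarith [h1.2, h2.1], by linarith [h1.1, h2.2]⟩
      · simp only [pow_zero, inv_one, mul_one]
        linarith
    · refine (EuclideanSpace.dist_le_three_mul (r := ((3 : ℝ) ^ k)⁻¹) fun j => ?_).trans ?_
      · have h1 := Int.abs_sub_lt_one_of_floor_eq_floor (congrFun (h k k.lt_succ_self) j)
        rw [add_sub_add_right_eq_sub, ← mul_sub, abs_mul, abs_of_pos (by positivity), pow_add,
          mul_assoc] at h1
        rw [← one_div, le_div_iff₀' (by positivity)]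
        refine le_trans ?_ h1.le
        exact le_mul_of_one_le_left (by positivity) h3n
      · have : (3 : ℝ) * (3 ^ k)⁻¹ = 9 * 1 * (3 ^ (k + 1))⁻¹ := by
          rw [pow_succ]; field_simp; norm_num
        rw [this]
        gcongr
  · refine ne_top_of_le_ne_top (b := (dustDim : ℝ≥0∞)) ENNReal.coe_ne_top ?_
    rw [← hf.dimH_image]
    refine (dimH_mono ?_).trans (dimH_dustSlices_le n)
    rintro _ ⟨x, -, rfl⟩
    exact hS x

lemma exists_basis_frontier_subset_dustSlices :
    ∃ B : Set (Set mengerSponge), IsTopologicalBasis B ∧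
      ∀ U ∈ B, ∃ n, ∀ x ∈ frontier U, (x : EuclideanSpace ℝ (Fin 3)) ∈ dustSlices n := by
  refine ⟨{U | IsOpen U ∧ ∃ n, ∀ x ∈ frontier U, (x : EuclideanSpace ℝ (Fin 3)) ∈ dustSlices n},
    isTopologicalBasis_of_isOpen_of_nhds (fun U hU => hU.1) ?_, fun U hU => hU.2⟩
  intro p W hp hW
  obtain ⟨ε, hε, hεW⟩ := Metric.isOpen_iff.1 hW p hp
  obtain ⟨n, hn⟩ := exists_pow_lt_of_lt_one (show (0 : ℝ) < ε / 6 by positivity)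
    (show (1 / 3 : ℝ) < 1 by norm_num)
  have h3 : (0 : ℝ) < 3 ^ n := by positivity
  let k : Fin 3 → ℤ := fun i => ⌈(3 : ℝ) ^ n * p.1 i - 1 / 2⌉ - 1
  have hk : ∀ i, (k i : ℝ) + 1 / 2 < 3 ^ n * p.1 i ∧ 3 ^ n * p.1 i < k i + 5 / 2 := by
    intro i
    have h1 := Int.le_ceil ((3 : ℝ) ^ n * p.1 i - 1 / 2)
    have h2 := Int.ceil_lt_add_one ((3 : ℝ) ^ n * p.1 i - 1 / 2)
    simp only [k]
    push_cast
    constructor <;> linarith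
  have hcont : ∀ i, Continuous fun x : mengerSponge => (3 : ℝ) ^ n * x.1 i := fun i => by fun_prop
  let U : Set mengerSponge :=
    {x | ∀ i, (k i : ℝ) + 1 / 2 < 3 ^ n * x.1 i ∧ 3 ^ n * x.1 i < k i + 5 / 2}
  have hUo : IsOpen U := by
    simp only [U, ofPred_forall]
    exact isOpen_iInter_of_finite fun i =>
      (isOpen_lt continuous_const (hcont i)).inter (isOpen_lt (hcont i) continuous_const)
  have hUc : closure U ⊆
      {x | ∀ i, (k i : ℝ) + 1 / 2 ≤ 3 ^ n * x.1 i ∧ 3 ^ n * x.1 i ≤ k i + 5 / 2} := by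
    refine closure_minimal (fun x hx i => ⟨(hx i).1.le, (hx i).2.le⟩) ?_
    simp only [ofPred_forall]
    exact isClosed_iInter fun i =>
      (isClosed_le continuous_const (hcont i)).inter (isClosed_le (hcont i) continuous_const)
  refine ⟨U, ⟨hUo, n, fun x hx => ?_⟩, hk, fun x hx => hεW ?_⟩
  · rw [hUo.frontier_eq] at hx
    obtain ⟨i, hi⟩ := not_forall.1 hx.2
    have hc := hUc hx.1 i
    rcases eq_or_lt_of_le hc.1 with h | h
    · exact mem_dustSlices_of_mem_mengerSponge x.2 h.symm
    · have h' : 3 ^ n * x.1 i = k i + 5 / 2 :=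
        le_antisymm hc.2 (not_lt.1 fun h' => hi ⟨h, h'⟩)
      refine mem_dustSlices_of_mem_mengerSponge x.2 (i := i) (q := k i + 2) ?_
      rw [h']
      push_cast
      ring
  · rw [Metric.mem_ball, Subtype.dist_eq]
    refine (EuclideanSpace.dist_le_three_mul (r := 2 * (1 / 3) ^ n) fun j => ?_).trans_lt
      (by linarith)
    rw [one_div, inv_pow, ← div_eq_mul_inv, le_div_iff₀' h3, ← abs_of_pos h3, ← abs_mul,
      mul_sub]
    exact abs_sub_le_iff.2 ⟨by linarith [(hx j).2, (hk j).1], by linarith [(hx j).1, (hk j).2]⟩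

/-- The vertical segment over a point of the plane. -/
noncomputable def verticalPoint (c : Fin 2 → ℝ) (t : ℝ) : EuclideanSpace ℝ (Fin 3) :=
  WithLp.toLp 2 ![c 0, c 1, t]

lemma verticalPoint_mem_mengerSponge {c : Fin 2 → ℝ} (hc : c ∈ cantorDust) {t : ℝ}
    (ht : t ∈ Icc (0 : ℝ) 1) : verticalPoint c t ∈ mengerSponge := by
  refine mem_iInter.2 fun n => ?_
  induction n generalizing c t with
  | zero =>
    intro i
    fin_cases i
    · exact cantorSet_subset_unitInterval (hc 0)
    · exact cantorSet_subset_unitInterval (hc 1)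
    · exact ht
  | succ n ih =>
    have hdig : ∀ j, ∃ d : Fin 3, d ≠ 1 ∧ ∃ y ∈ cantorSet, c j = (y + ((d : ℕ) : ℝ)) / 3 := by
      intro j
      obtain ⟨y, hy, h | h⟩ := mem_cantorSet_imp (hc j)
      · exact ⟨0, by decide, y, hy, by simp [h]⟩
      · exact ⟨2, by decide, y, hy, by simp [h, add_comm]⟩
    have hdig' : ∃ d : Fin 3, ∃ y ∈ Icc (0 : ℝ) 1, t = (y + ((d : ℕ) : ℝ)) / 3 := by
      rcases le_total t (1 / 3) with h | h
      · exact ⟨0, 3 * t, ⟨by linarith [ht.1], by linarith⟩, by simp⟩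
      rcases le_total t (2 / 3) with h' | h'
      · exact ⟨1, 3 * t - 1, ⟨by linarith, by linarith⟩, by simp⟩
      · exact ⟨2, 3 * t - 2, ⟨by linarith, by linarith [ht.2]⟩, by simp⟩
    choose d hd y hy hcy using hdig
    obtain ⟨e, z, hz, htz⟩ := hdig'
    refine mem_preMengerSponge_succ.2 ⟨![d 0, d 1, e], ?_, verticalPoint y z, ih hy hz, ?_⟩
    · have h0 := hd 0
      have h1 := hd 1
      intro i j
      fin_cases i <;> fin_cases j <;> simp [h0, h1]
    · intro j
      fin_cases j
      · exact hcy 0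
      · exact hcy 1
      · exact htz

lemma continuous_verticalPoint (c : Fin 2 → ℝ) : Continuous (verticalPoint c) := by
  unfold verticalPoint
  refine (PiLp.continuous_toLp 2 _).comp (continuous_pi fun i => ?_)
  fin_cases i
  · exact continuous_const
  · exact continuous_const
  · exact continuous_id

lemma div_three_pow_mem_cantorDust {c : Fin 2 → ℝ} (hc : c ∈ cantorDust) (n : ℕ) :
    (fun j => c j / 3 ^ n) ∈ cantorDust := by
  induction n with
  | zero => simpa using hc
  | succ n ih =>
    intro j
    rw [cantorSet_eq_union_halves]
    exact Or.inl ⟨_, ih j, by simp only [pow_succ, div_div]⟩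

lemma exists_mem_basis_dustDim_le_dimH_frontier {B : Set (Set mengerSponge)}
    (hB : IsTopologicalBasis B) :
    ∃ U ∈ B, (frontier U).Nonempty ∧ (dustDim : ℝ≥0∞) ≤ dimH (frontier U) := by
  have h0 : (0 : Fin 2 → ℝ) ∈ cantorDust := fun _ => zero_mem_cantorSet
  let p : mengerSponge := ⟨_, verticalPoint_mem_mengerSponge h0 (left_mem_Icc.2 zero_le_one)⟩
  obtain ⟨U, hUB, hpU, hU1⟩ := hB.exists_subset_of_mem_open
    (Metric.mem_ball_self (x := p) one_pos) Metric.isOpen_ball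
  obtain ⟨ε, hε, hεU⟩ := Metric.isOpen_iff.1 (hB.isOpen hUB) p hpU
  obtain ⟨n, hn⟩ := exists_pow_lt_of_lt_one (show (0 : ℝ) < ε / 3 by positivity)
    (show (1 / 3 : ℝ) < 1 by norm_num)
  have h3 : (0 : ℝ) < 3 ^ n := by positivity
  let proj : mengerSponge → Fin 2 → ℝ := fun x => ![3 ^ n * x.1 0, 3 ^ n * x.1 1]
  have hproj : LipschitzWith (3 ^ n) proj := by
    refine LipschitzWith.of_dist_le_mul fun x y => (dist_pi_le_iff (by positivity)).2 fun j => ?_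
    push_cast
    fin_cases j
    · simp only [proj, Real.dist_eq, Fin.zero_eta, Matrix.cons_val_zero]
      rw [← mul_sub, abs_mul, abs_of_pos h3]
      gcongr
      exact EuclideanSpace.abs_sub_apply_le_dist _ _ _
    · simp only [proj, Real.dist_eq, Fin.mk_one, Matrix.cons_val_one, Matrix.cons_val_zero]
      rw [← mul_sub, abs_mul, abs_of_pos h3]
      gcongr
      exact EuclideanSpace.abs_sub_apply_le_dist _ _ _
  have himg : cantorDust ⊆ proj '' frontier U := by
    intro c hc
    have hc' := div_three_pow_mem_cantorDust hc n
    let γ : Icc (0 : ℝ) 1 → mengerSponge := fun t => ⟨_, verticalPoint_mem_mengerSponge hc' t.2⟩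
    have hγ : Continuous γ :=
      ((continuous_verticalPoint _).comp continuous_subtype_val).subtype_mk _
    have hs : γ 0 ∈ U := by
      refine hεU ?_
      rw [Metric.mem_ball, Subtype.dist_eq]
      refine (EuclideanSpace.dist_le_three_mul (r := (1 / 3) ^ n) fun j => ?_).trans_lt
        (by linarith)
      have hcj : ∀ j, |c j / 3 ^ n - 0| ≤ (1 / 3) ^ n := fun j => by
        have := cantorSet_subset_unitInterval (hc j)
        rw [sub_zero, abs_of_nonneg (div_nonneg this.1 h3.le), one_div, inv_pow, ← one_div]
        gcongr
        exact this.2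
      fin_cases j
      · exact hcj 0
      · exact hcj 1
      · simp [γ, p, verticalPoint]
    have he : γ 1 ∉ U := by
      intro h
      have h1 := Metric.mem_ball.1 (hU1 h)
      rw [Subtype.dist_eq] at h1
      have h2 := (EuclideanSpace.abs_sub_apply_le_dist _ _ 2).trans_lt h1
      simp [γ, p, verticalPoint] at h2
    obtain ⟨t, ht⟩ := nonempty_frontier_iff.2
      ⟨(⟨0, hs⟩ : (γ ⁻¹' U).Nonempty), fun h => he (h ▸ mem_univ (1 : Icc (0 : ℝ) 1) :)⟩
    replace ht : γ t ∈ frontier U := hγ.frontier_preimage_subset U ht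
    refine ⟨γ t, ht, funext fun j => ?_⟩
    fin_cases j
    · simp only [proj, γ, verticalPoint, Fin.zero_eta, Matrix.cons_val_zero]
      field_simp
    · simp only [proj, γ, verticalPoint, Fin.mk_one, Matrix.cons_val_one, Matrix.cons_val_zero]
      field_simp
  refine ⟨U, hUB, (image_nonempty.1 (Nonempty.mono himg ⟨0, h0⟩)), ?_⟩
  exact le_dimH_cantorDust.trans ((dimH_mono himg).trans (hproj.dimH_image_le _))

lemma mengerSponge_nonempty : mengerSponge.Nonempty :=
  ⟨_, verticalPoint_mem_mengerSponge (c := 0) (fun _ => zero_mem_cantorSet)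
    (left_mem_Icc.2 zero_le_one)⟩

theorem mainTheorem10 :
    topologicalHausdorffDim mengerSponge = ((1 + Real.log 4 / Real.log 3 : ℝ) : EReal) ∧
      topologicalConformalDim mengerSponge = 1 := by
  have hne : ¬ IsEmpty mengerSponge := not_isEmpty_iff.2 mengerSponge_nonempty.to_subtype
  obtain ⟨B, hB, hfr⟩ := exists_basis_frontier_subset_dustSlices
  have hcoe : ((dustDim : ℝ≥0∞) : EReal) = ((Real.log 4 / Real.log 3 : ℝ) : EReal) := rfl
  rw [topologicalHausdorffDim, topologicalConformalDim, if_neg hne, if_neg hne]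
  refine ⟨le_antisymm (sInf_le ⟨B, hB, fun U hU => ?_⟩) (le_sInf ?_),
    le_antisymm (sInf_le ⟨B, hB, fun U hU => ?_⟩) (le_sInf ?_)⟩
  · obtain ⟨n, hn⟩ := hfr U hU
    have h1 : ((1 + Real.log 4 / Real.log 3 : ℝ) : EReal) - 1 =
        ((Real.log 4 / Real.log 3 : ℝ) : EReal) := by
      rw [← EReal.coe_one, ← EReal.coe_sub, add_sub_cancel_left]
    rw [h1, ← hcoe]
    refine (hausdorffDim_le _).trans (EReal.coe_ennreal_le_coe_ennreal_iff.2 ?_)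
    rw [← isometry_subtype_coe.dimH_image]
    refine (dimH_mono ?_).trans (dimH_dustSlices_le n)
    rintro _ ⟨x, hx, rfl⟩
    exact hn x hx
  · rintro c ⟨B', hB', h⟩
    obtain ⟨U, hU, hUne, hUd⟩ := exists_mem_basis_dustDim_le_dimH_frontier hB'
    have h1 := h U hU
    rw [hausdorffDim_of_nonempty hUne] at h1
    have h2 := (EReal.coe_ennreal_le_coe_ennreal_iff.2 hUd).trans h1
    rw [hcoe] at h2
    have h3 := EReal.add_le_of_le_sub h2
    rwa [EReal.coe_add, EReal.coe_one, add_comm]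
  · obtain ⟨n, hn⟩ := hfr U hU
    have h1 : (1 : EReal) - 1 = 0 := by
      rw [← EReal.coe_one, ← EReal.coe_sub, sub_self, EReal.coe_zero]
    rw [h1]
    exact conformalDim_nonpos_of_dustSlices (n := n)
      (isometry_subtype_coe.comp isometry_subtype_coe) (fun x => hn x.1 x.2)
      fun x j => preMengerSponge_subset_cube 0 (mem_iInter.1 x.1.2 0) j
  · rintro c ⟨B', hB', h⟩
    obtain ⟨U, hU, hUne, -⟩ := exists_mem_basis_dustDim_le_dimH_frontier hB'
    have := hUne.to_subtype
    have h2 := (conformalDim_nonneg (frontier U)).trans (h U hU)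
    simpa using EReal.add_le_of_le_sub h2
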